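/- Let $F$ be a nonarchimedean local field with normalized absolute value $|\cdot|$, let $\theta$ be a nontrivial continuous unitary additive character of $F$, let $m\ge 0$, $n=2m+1$, $G_k=GL_k(F)$, and write $|g|=|\det g|$ for a square matrix $g$. Let $P_n\subset G_n$ be the mirabolic subgroup (last row $(0,\dots,0,1)$). In blocks of sizes $m,m,1$ let $S_n$ be the group of matrices $\begin{pmatrix} g&z&y\\ &g&\\ &x&1\end{pmatrix}$ with $g\in G_m$, and $L_n$ the group of invertible matrices $\begin{pmatrix} g_1&&u\\ &g_2&\\ v&&l\end{pmatrix}$. Let $\Theta$ be the character of $P_n\cap S_n$ given by $$\Theta\left(\begin{pmatrix} I_m&z&\\ &I_m&\\ &&1\end{pmatrix}\begin{pmatrix} g&&\\ &g&\\ &&1\end{pmatrix}\begin{pmatrix} I_m&&y\\ &I_m&\\ &&1\end{pmatrix}\right)=\theta(\mathrm{Tr}\,z),$$ and for $s\in\mathbb C$ let $\chi_s$ be the character of $P_n\cap L_n$ given by $\chi_s\begin{pmatrix} g_1&&u\\ &g_2&\\ &&1\end{pmatrix}=(|g_1|/|g_2|)^{-s}$. For a subgroup $H\subset G_n$, a representation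 $\Pi$ of $G_n$ on a complex vector space and a character $\chi$ of $H$, let $\mathrm{Hom}_H(\Pi,\chi)$ be the space of linear forms $L$ on $\Pi$ with $L(\Pi(h)v)=\chi(h)L(v)$ for all $h\in H$ and $v\in\Pi$. Let $\Pi$ be a smooth complex representation of $G_n$, let $dg$ be a Haar measure on $G_m$, and let $r_\Pi\in[-\infty,\infty]$ be the infimum of the real numbers $r$ such that, for all $L\in \mathrm{Hom}_{P_n\cap S_n}(\Pi,\Theta)$, all $v\in\Pi$ and all $s\in\mathbb C$ with $\mathrm{Re}(s)>r$, the integral $\int_{G_m}L(\Pi(\mathrm{diag}(g,I_{m+1}))v)|g|^{s}\,dg$ converges absolutely. **Proposition.** Let $s_0$ be a real number with $s_0>r_\Pi$. Then for all $L\in\mathrm{Hom}_{P_n\cap S_n}(\Pi,\Theta)$ and $v\in\Pi$ the integral $$\Gamma_L(v)=\int_{G_m}L(\Pi(\mathrm{diag}(g,I_{m+1}))v)\,|g|^{s_0}\,dg$$ converges absolutely, $\Gamma_L$ belongs to $\mathrm{Hom}_{P_n\cap L_n}(\Pi,\chi_{s_0})$, and $L\mapsto\Gamma_L$ is an injective linear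 map from $\mathrm{Hom}_{P_n\cap S_n}(\Pi,\Theta)$ to $\mathrm{Hom}_{P_n\cap L_n}(\Pi,\chi_{s_0})$. -/

import Mathlib

open MeasureTheory Matrix
open scoped ValuativeRel WithZero NNReal

set_option linter.unusedSectionVars false

noncomputable section

namespace ExteriorSquare

/-! ### The normalized absolute value -/

section AbsoluteValue

variable (F : Type*) [Field F] [ValuativeRel F] [TopologicalSpace F] [IsNonarchimedeanLocalField F]

/-- The cardinality `q` of the residue field of `F`. -/
def resCard : ℝ≥0 := (Nat.card 𝓀[F] : ℝ≥0)

theorem resCard_ne_zero : resCard F ≠ 0 := by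
  unfold resCard
  exact_mod_cast (Nat.card_pos (α := 𝓀[F])).ne'

/-- The normalized absolute value `|a| = q ^ (- val a)` on `F`, with `|0| = 0`. The canonical
valuation of `F` is read in `ℤᵐ⁰` through the (unique) isomorphism of ordered groups, which sends
the value of a uniformizer to the generator `-1` of `ℤ` (written multiplicatively). -/
def absF : F →*₀ ℝ≥0 :=
  ((WithZeroMulInt.toNNReal (resCard_ne_zero F)).comp
    (MonoidWithZeroHom.ofClass
      (IsNonarchimedeanLocalField.valueGroupWithZeroIsoInt F))).comp
    (ValuativeRel.valuation F).toMonoidWithZeroHom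

variable {F}

/-- `|g| = |det g|`, for a square matrix `g`. -/
def absDet {m : ℕ} (g : Matrix (Fin m) (Fin m) F) : ℝ := (absF F g.det : ℝ)

theorem absDet_nonneg {m : ℕ} (g : Matrix (Fin m) (Fin m) F) : 0 ≤ absDet g :=
  NNReal.coe_nonneg _

theorem absDet_mul {m : ℕ} (g h : Matrix (Fin m) (Fin m) F) :
    absDet (g * h) = absDet g * absDet h := by
  simp [absDet]

theorem absDet_one {m : ℕ} : absDet (1 : Matrix (Fin m) (Fin m) F) = 1 := by
  simp [absDet]

end AbsoluteValue

/-! ### Block matrices of size `n = 2m + 1` and the subgroups `P_n`, `S_n`, `L_n` -/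

section Groups

variable {F : Type*} [Field F] {m : ℕ}

/-- The index set of size `n = 2m + 1`, split in three blocks of sizes `m`, `m`, `1`. -/
abbrev Ix (m : ℕ) : Type := (Fin m ⊕ Fin m) ⊕ Unit

/-- The group `G_n = GL_{2m+1}(F)`, with rows and columns indexed by the blocks `m`, `m`, `1`. -/
abbrev Gn (F : Type*) [Field F] (m : ℕ) : Type _ := GL (Ix m) F

/-- The `n × n` matrix with blocks
```
a b c
d e f
p r l
```
of sizes `m`, `m`, `1`. -/
def blk (a b : Matrix (Fin m) (Fin m) F) (c : Matrix (Fin m) Unit F)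
    (d e : Matrix (Fin m) (Fin m) F) (f : Matrix (Fin m) Unit F)
    (p r : Matrix Unit (Fin m) F) (l : Matrix Unit Unit F) : Matrix (Ix m) (Ix m) F :=
  fromBlocks (fromBlocks a b d e) (fromRows c f) (fromCols p r) l

theorem blk_mul (a b c d e f p r l a' b' c' d' e' f' p' r' l') :
    (blk a b c d e f p r l : Matrix (Ix m) (Ix m) F) * blk a' b' c' d' e' f' p' r' l' =
      blk (a * a' + b * d' + c * p') (a * b' + b * e' + c * r') (a * c' + b * f' + c * l')
        (d * a' + e * d' + f * p') (d * b' + e * e' + f * r') (d * c' + e * f' + f * l')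
        (p * a' + r * d' + l * p') (p * b' + r * e' + l * r') (p * c' + r * f' + l * l') := by
  ext i j
  rcases i with (i | i) | i <;> rcases j with (j | j) | j <;>
    simp [blk, Matrix.mul_apply, Fintype.sum_sum_type, Matrix.add_apply]

theorem blk_one : (blk 1 0 0 0 1 0 0 0 1 : Matrix (Ix m) (Ix m) F) = 1 := by
  ext i j
  rcases i with (i | i) | i <;> rcases j with (j | j) | j <;>
    simp [blk, Matrix.one_apply]

theorem blk_inj {a b c d e f p r l a' b' c' d' e' f' p' r' l'}
    (h : (blk a b c d e f p r l : Matrix (Ix m) (Ix m) F) = blk a' b' c' d' e' f' p' r' l') :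
    a = a' ∧ b = b' ∧ c = c' ∧ d = d' ∧ e = e' ∧ f = f' ∧ p = p' ∧ r = r' ∧ l = l' := by
  simp only [blk, Matrix.fromBlocks_inj, Matrix.fromRows_ext_iff, Matrix.fromCols_ext_iff,
    and_assoc] at h
  tauto

/-- Every matrix is made of blocks. -/
theorem exists_blk (M : Matrix (Ix m) (Ix m) F) :
    ∃ a b c d e f p r l, M = blk a b c d e f p r l := by
  refine ⟨M.toBlocks₁₁.toBlocks₁₁, M.toBlocks₁₁.toBlocks₁₂, M.toBlocks₁₂.toRows₁,
    M.toBlocks₁₁.toBlocks₂₁, M.toBlocks₁₁.toBlocks₂₂, M.toBlocks₁₂.toRows₂,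
    M.toBlocks₂₁.toCols₁, M.toBlocks₂₁.toCols₂, M.toBlocks₂₂, ?_⟩
  simp [blk, Matrix.fromBlocks_toBlocks]

theorem inv_val_of_mul_eq_one {k : Type*} [Fintype k] [DecidableEq k] (M : GL k F)
    (N : Matrix k k F) (h : (M : Matrix k k F) * N = 1) : ((M⁻¹ : GL k F) : Matrix k k F) = N := by
  rw [Matrix.coe_units_inv]
  exact Matrix.inv_eq_right_inv h

variable (F m)

/-- The mirabolic subgroup `P_n = G_{n-1} U_n` of `G_n`: last row equal to `(0, …, 0, 1)`. -/
def mirabolic : Subgroup (Gn F m) where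
  carrier := {M | ∃ (h : GL (Fin m ⊕ Fin m) F) (x : Matrix (Fin m ⊕ Fin m) Unit F),
    (M : Matrix (Ix m) (Ix m) F) = fromBlocks h.val x 0 1}
  one_mem' := ⟨1, 0, by simp [Matrix.fromBlocks_one]⟩
  mul_mem' := by
    rintro A B ⟨h, x, hA⟩ ⟨h', x', hB⟩
    exact ⟨h * h', h.val * x' + x, by simp [hA, hB, Matrix.fromBlocks_multiply]⟩
  inv_mem' := by
    rintro A ⟨h, x, hA⟩
    refine ⟨h⁻¹, -((h⁻¹ : GL (Fin m ⊕ Fin m) F).val * x), ?_⟩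
    apply inv_val_of_mul_eq_one
    have hh : h.val * (h⁻¹ : GL (Fin m ⊕ Fin m) F).val = 1 := by
      rw [← Units.val_mul, mul_inv_cancel, Units.val_one]
    rw [hA, Matrix.fromBlocks_multiply, ← Matrix.fromBlocks_one, Matrix.mul_neg,
      ← Matrix.mul_assoc, hh]
    simp

/-- The Shalika subgroup `S_n` of `G_n`: the matrices
```
g z y
0 g 0
0 x 1
```
with `g ∈ G_m`. -/
def shalika : Subgroup (Gn F m) where
  carrier := {M | ∃ (g : GL (Fin m) F) (z : Matrix (Fin m) (Fin m) F) (y : Matrix (Fin m) Unit F)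
    (x : Matrix Unit (Fin m) F),
    (M : Matrix (Ix m) (Ix m) F) = blk g.val z y 0 g.val 0 0 x 1}
  one_mem' := ⟨1, 0, 0, 0, by simp [blk_one]⟩
  mul_mem' := by
    rintro A B ⟨g, z, y, x, hA⟩ ⟨g', z', y', x', hB⟩
    refine ⟨g * g', g.val * z' + z * g'.val + y * x',
      g.val * y' + y, x * g'.val + x', ?_⟩
    rw [Units.val_mul, hA, hB, blk_mul]
    simp
  inv_mem' := by
    rintro A ⟨g, z, y, x, hA⟩
    have hg : (g : Matrix (Fin m) (Fin m) F) * (g⁻¹ : GL (Fin m) F).val = 1 := by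
      rw [← Units.val_mul, mul_inv_cancel, Units.val_one]
    generalize hk : (g⁻¹ : GL (Fin m) F).val = k at hg
    refine ⟨g⁻¹, -(k * (z * k)) + k * (y * (x * k)), -(k * y), -(x * k), ?_⟩
    apply inv_val_of_mul_eq_one
    rw [hA, hk, blk_mul, ← blk_one]
    congr 1 <;> simp [mul_add, Matrix.mul_add, ← Matrix.mul_assoc, hg]

/-- The Levi subgroup `L_n` of type `(m + 1, m)` of `G_n`: the invertible matrices
```
g₁ 0  u
0  g₂ 0
v  0  l
```
-/
def levi : Subgroup (Gn F m) where
  carrier := {M | ∃ (g₁ g₂ : Matrix (Fin m) (Fin m) F) (u : Matrix (Fin m) Unit F)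
    (v : Matrix Unit (Fin m) F) (l : Matrix Unit Unit F),
    (M : Matrix (Ix m) (Ix m) F) = blk g₁ 0 u 0 g₂ 0 v 0 l}
  one_mem' := ⟨1, 1, 0, 0, 1, by simp [blk_one]⟩
  mul_mem' := by
    rintro A B ⟨a, e, u, v, l, hA⟩ ⟨a', e', u', v', l', hB⟩
    refine ⟨a * a' + u * v', e * e', a * u' + u * l', v * a' + l * v', v * u' + l * l', ?_⟩
    rw [Units.val_mul, hA, hB, blk_mul]
    simp
  inv_mem' := by
    rintro A ⟨a₀, e₀, u₀, v₀, l₀, hA⟩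
    set E : Matrix (Ix m) (Ix m) F := blk 0 0 0 0 1 0 0 0 0 with hE
    have h1 : (A : Matrix (Ix m) (Ix m) F) * E = E * A := by
      rw [hA, hE, blk_mul, blk_mul]
      simp
    have h2 : ((A⁻¹ : Gn F m) : Matrix (Ix m) (Ix m) F) * E = E * (A⁻¹ : Gn F m).val :=
      ((show Commute (A : Matrix (Ix m) (Ix m) F) E from h1).units_inv_left).eq
    obtain ⟨a, b, c, d, e, f, p, r, l, hB⟩ := exists_blk ((A⁻¹ : Gn F m) : Matrix (Ix m) (Ix m) F)
    rw [hB, hE, blk_mul, blk_mul] at h2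
    have h3 := blk_inj h2
    simp only [Matrix.mul_zero, Matrix.mul_one, Matrix.zero_mul, Matrix.one_mul, add_zero,
      zero_add] at h3
    obtain ⟨-, hb, -, hd, -, hf, -, hr, -⟩ := h3
    refine ⟨a, e, c, p, l, ?_⟩
    change ((A⁻¹ : Gn F m) : Matrix (Ix m) (Ix m) F) = _
    rw [hB, hb, ← hd, ← hf, hr]

variable {F m}

/-- The element `diag(g, I_{m+1})` of `G_n`, for `g ∈ G_m`. -/
def diagEmb (g : GL (Fin m) F) : Gn F m where
  val := blk g.val 0 0 0 1 0 0 0 1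
  inv := blk (g⁻¹ : GL (Fin m) F).val 0 0 0 1 0 0 0 1
  val_inv := by
    rw [blk_mul, ← blk_one]
    simp [-Matrix.coe_units_inv]
  inv_val := by
    rw [blk_mul, ← blk_one]
    simp [-Matrix.coe_units_inv]

/-- The `m × m` block of `M` in position `(1, 1)`. -/
def block₁₁ (M : Gn F m) : Matrix (Fin m) (Fin m) F :=
  (M : Matrix (Ix m) (Ix m) F).toBlocks₁₁.toBlocks₁₁

/-- The `m × m` block of `M` in position `(1, 2)`. -/
def block₁₂ (M : Gn F m) : Matrix (Fin m) (Fin m) F :=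
  (M : Matrix (Ix m) (Ix m) F).toBlocks₁₁.toBlocks₁₂

/-- The `m × m` block of `M` in position `(2, 2)`. -/
def block₂₂ (M : Gn F m) : Matrix (Fin m) (Fin m) F :=
  (M : Matrix (Ix m) (Ix m) F).toBlocks₁₁.toBlocks₂₂

theorem blocks_of_eq_blk {M : Gn F m} {a b c d e f p r l}
    (h : (M : Matrix (Ix m) (Ix m) F) = blk a b c d e f p r l) :
    block₁₁ M = a ∧ block₁₂ M = b ∧ block₂₂ M = e := by
  simp [block₁₁, block₁₂, block₂₂, h, blk]

/-- The shape of the elements of `P_n ∩ S_n`. -/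
theorem mem_mirabolic_inf_shalika_iff (M : Gn F m) : M ∈ mirabolic F m ⊓ shalika F m ↔
    ∃ (g : GL (Fin m) F) (z : Matrix (Fin m) (Fin m) F) (y : Matrix (Fin m) Unit F),
      (M : Matrix (Ix m) (Ix m) F) = blk g.val z y 0 g.val 0 0 0 1 := by
  constructor
  · rintro ⟨⟨h, w, hM⟩, ⟨g, z, y, x, hM'⟩⟩
    refine ⟨g, z, y, ?_⟩
    have := hM.symm.trans hM'
    simp only [blk, Matrix.fromBlocks_inj] at this
    rw [hM']
    have h0 := this.2.2.1
    rw [← Matrix.fromCols_zero, Matrix.fromCols_ext_iff] at h0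
    rw [← h0.2]
  · rintro ⟨g, z, y, hM⟩
    refine ⟨?_, g, z, y, 0, hM⟩
    have hdet : IsUnit (fromBlocks (g : Matrix (Fin m) (Fin m) F) z 0 g.val).det := by
      rw [Matrix.det_fromBlocks_zero₂₁]
      have := (Matrix.isUnit_iff_isUnit_det _).1 g.isUnit
      exact this.mul this
    refine ⟨Matrix.nonsingInvUnit _ hdet, fromRows y 0, ?_⟩
    rw [hM]
    simp [blk, Matrix.nonsingInvUnit]

/-- The shape of the elements of `P_n ∩ L_n`. -/
theorem mem_mirabolic_inf_levi_iff (M : Gn F m) : M ∈ mirabolic F m ⊓ levi F m ↔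
    ∃ (g₁ g₂ : GL (Fin m) F) (u : Matrix (Fin m) Unit F),
      (M : Matrix (Ix m) (Ix m) F) = blk g₁.val 0 u 0 g₂.val 0 0 0 1 := by
  constructor
  · rintro ⟨⟨h, w, hM⟩, ⟨a, e, u, v, l, hM'⟩⟩
    have := hM.symm.trans hM'
    simp only [blk, Matrix.fromBlocks_inj] at this
    obtain ⟨h1, -, h0, hl⟩ := this
    rw [← Matrix.fromCols_zero, Matrix.fromCols_ext_iff] at h0
    have hdet := (Matrix.isUnit_iff_isUnit_det _).1 h.isUnit
    rw [h1, Matrix.det_fromBlocks_zero₂₁, IsUnit.mul_iff] at hdet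
    refine ⟨Matrix.nonsingInvUnit _ hdet.1, Matrix.nonsingInvUnit _ hdet.2, u, ?_⟩
    rw [hM', ← hl, ← h0.1]
    simp [Matrix.nonsingInvUnit]
  · rintro ⟨g₁, g₂, u, hM⟩
    refine ⟨?_, g₁, g₂, u, 0, 1, hM⟩
    have hdet : IsUnit
        (fromBlocks (g₁ : Matrix (Fin m) (Fin m) F) 0 0 (g₂ : Matrix (Fin m) (Fin m) F)).det := by
      rw [Matrix.det_fromBlocks_zero₂₁]
      exact ((Matrix.isUnit_iff_isUnit_det _).1 g₁.isUnit).mul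
        ((Matrix.isUnit_iff_isUnit_det _).1 g₂.isUnit)
    refine ⟨Matrix.nonsingInvUnit _ hdet, fromRows u 0, ?_⟩
    rw [hM]
    simp [blk, Matrix.nonsingInvUnit]

end Groups

/-! ### The characters `Θ` of `P_n ∩ S_n` and `χ_s` of `P_n ∩ L_n` -/

section Characters

variable {F : Type*} [Field F] {m : ℕ}

/-- The character `Θ` of `P_n ∩ S_n`. The matrix with blocks `g z' y'`, `0 g 0`, `0 0 1` is the
product of the matrix with blocks `1 z 0`, `0 1 0`, `0 0 1`, of `diag(g, g, 1)` and of the matrix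
with blocks `1 0 y`, `0 1 0`, `0 0 1`, exactly for `z = z' g⁻¹` and `y = g⁻¹ y'`, and the value
of `Θ` on it is `θ (Tr z)` (see `charTheta_apply`). -/
def charTheta (θ : AddChar F Circle) : ↥(mirabolic F m ⊓ shalika F m) →* ℂ where
  toFun M := (θ (Matrix.trace (block₁₂ M.1 * (block₁₁ M.1)⁻¹)) : ℂ)
  map_one' := by
    have h := blocks_of_eq_blk (M := (1 : Gn F m)) (by rw [Units.val_one, ← blk_one])
    simp [h.1, h.2.1]
  map_mul' := by
    rintro ⟨M, hM⟩ ⟨N, hN⟩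
    obtain ⟨g, z, y, hM⟩ := (mem_mirabolic_inf_shalika_iff M).1 hM
    obtain ⟨g', z', y', hN⟩ := (mem_mirabolic_inf_shalika_iff N).1 hN
    have hMN := (Units.val_mul M N).trans ((congrArg₂ (· * ·) hM hN).trans
      (blk_mul _ _ _ _ _ _ _ _ _ _ _ _ _ _ _ _ _ _))
    have h1 := blocks_of_eq_blk hM
    have h2 := blocks_of_eq_blk hN
    have h3 := blocks_of_eq_blk hMN
    simp only [MulMemClass.mk_mul_mk, h1.1, h1.2.1, h2.1, h2.2.1, h3.1, h3.2.1,
      Matrix.mul_zero, add_zero]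
    rw [← Circle.coe_mul, ← AddChar.map_add_eq_mul]
    congr 2
    have hg := (Matrix.isUnit_iff_isUnit_det _).1 g.isUnit
    have hg' := (Matrix.isUnit_iff_isUnit_det _).1 g'.isUnit
    rw [Matrix.mul_inv_rev, Matrix.add_mul, Matrix.trace_add, add_comm]
    congr 1
    · rw [Matrix.mul_assoc, Matrix.mul_nonsing_inv_cancel_left _ _ hg']
    · rw [Matrix.mul_assoc, Matrix.trace_mul_comm, Matrix.mul_assoc,
        Matrix.nonsing_inv_mul_cancel_right _ _ hg]

/-- `Θ (n(z) diag(g, g, 1) u(y)) = θ (Tr z)`. -/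
theorem charTheta_apply (θ : AddChar F Circle) (M : ↥(mirabolic F m ⊓ shalika F m))
    (z : Matrix (Fin m) (Fin m) F) (g : GL (Fin m) F) (y : Matrix (Fin m) Unit F)
    (hM : (M.1 : Matrix (Ix m) (Ix m) F) =
      blk 1 z 0 0 1 0 0 0 1 * blk g.val 0 0 0 g.val 0 0 0 1 *
        blk 1 0 y 0 1 0 0 0 1) :
    charTheta θ M = (θ (Matrix.trace z) : ℂ) := by
  rw [blk_mul, blk_mul] at hM
  have h := blocks_of_eq_blk hM
  have hg := (Matrix.isUnit_iff_isUnit_det _).1 g.isUnit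
  change (θ (Matrix.trace (block₁₂ M.1 * (block₁₁ M.1)⁻¹)) : ℂ) = _
  rw [h.1, h.2.1]
  simp [Matrix.mul_nonsing_inv_cancel_right _ _ hg]

variable [ValuativeRel F] [TopologicalSpace F] [IsNonarchimedeanLocalField F]

/-- The character `χ_s` of `P_n ∩ L_n`, whose value on the matrix with blocks `g₁ 0 u`, `0 g₂ 0`,
`0 0 1` is `(|g₁| / |g₂|) ^ (-s)`. -/
def charChi (s : ℂ) : ↥(mirabolic F m ⊓ levi F m) →* ℂ where
  toFun M := ((absDet (block₁₁ M.1) / absDet (block₂₂ M.1) : ℝ) : ℂ) ^ (-s)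
  map_one' := by
    have h := blocks_of_eq_blk (M := (1 : Gn F m)) (by rw [Units.val_one, ← blk_one])
    simp [h.1, h.2.2, absDet_one]
  map_mul' := by
    rintro ⟨M, hM⟩ ⟨N, hN⟩
    obtain ⟨g, g₂, y, hM⟩ := (mem_mirabolic_inf_levi_iff M).1 hM
    obtain ⟨g', g₂', y', hN⟩ := (mem_mirabolic_inf_levi_iff N).1 hN
    have hMN := (Units.val_mul M N).trans ((congrArg₂ (· * ·) hM hN).trans
      (blk_mul _ _ _ _ _ _ _ _ _ _ _ _ _ _ _ _ _ _))
    have h1 := blocks_of_eq_blk hM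
    have h2 := blocks_of_eq_blk hN
    have h3 := blocks_of_eq_blk hMN
    simp only [MulMemClass.mk_mul_mk, h1.1, h1.2.2, h2.1, h2.2.2, h3.1, h3.2.2,
      Matrix.mul_zero, add_zero, zero_add, absDet_mul]
    rw [← Complex.mul_cpow_ofReal_nonneg
      (div_nonneg (absDet_nonneg _) (absDet_nonneg _))
      (div_nonneg (absDet_nonneg _) (absDet_nonneg _)), ← Complex.ofReal_mul, div_mul_div_comm]

end Characters

/-! ### Representations, spaces of quasi-invariant linear forms, the integrals -/

/-- A representation of a topological group is smooth if every vector is fixed by an open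
subgroup. -/
def IsSmoothRep {G V : Type*} [Group G] [TopologicalSpace G] [AddCommGroup V] [Module ℂ V]
    (ρ : Representation ℂ G V) : Prop :=
  ∀ v : V, ∃ U : Subgroup G, IsOpen (U : Set G) ∧ ∀ u ∈ U, ρ u v = v

/-- `Hom_H(ρ, χ)`: the linear forms `L` on the space of `ρ` such that `L (ρ(h) v) = χ(h) L(v)` for
all `h` in the subgroup `H`. -/
def homSpace {G V : Type*} [Group G] [AddCommGroup V] [Module ℂ V]
    (ρ : Representation ℂ G V) (H : Subgroup G) (χ : ↥H →* ℂ) : Submodule ℂ (Module.Dual ℂ V) where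
  carrier := {L | ∀ (h : ↥H) (v : V), L (ρ (h : G) v) = χ h * L v}
  zero_mem' := by intro h v; simp
  add_mem' := by
    intro L L' hL hL' h v
    simp [hL h v, hL' h v, mul_add]
  smul_mem' := by
    intro c L hL h v
    simp [hL h v, mul_left_comm]

section Integrals

variable {F : Type*} [Field F] [ValuativeRel F] [TopologicalSpace F] [IsNonarchimedeanLocalField F]
  {m : ℕ} {V : Type*} [AddCommGroup V] [Module ℂ V]

/-- The function `g ↦ S_{L,v}(diag(g, I_{m+1})) |g| ^ s` on `G_m`, where
`S_{L,v}(h) = L (ρ(h) v)`. -/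
def integrand (ρ : Representation ℂ (Gn F m) V) (L : Module.Dual ℂ V) (v : V) (s : ℂ)
    (g : GL (Fin m) F) : ℂ :=
  L (ρ (diagEmb g) v) * ((absDet (g : Matrix (Fin m) (Fin m) F) : ℝ) : ℂ) ^ s

variable [MeasurableSpace (GL (Fin m) F)]

/-- The abscissa of absolute convergence `r_ρ`: the infimum, in `[-∞, ∞]`, of the real numbers `r`
such that the integrals `∫ S_{L,v}(diag(g, I_{m+1})) |g| ^ s dg` over `G_m` are absolutely
convergent for all `L` in `Hom_{P_n ∩ S_n}(ρ, Θ)`, all `v`, and all `s` with `Re s > r`. A real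
number is greater than it if and only if it is greater than some such `r`. -/
def abscissa (ρ : Representation ℂ (Gn F m) V) (θ : AddChar F Circle)
    (dg : Measure (GL (Fin m) F)) : EReal :=
  ⨅ r ∈ {r : ℝ | ∀ L ∈ homSpace ρ (mirabolic F m ⊓ shalika F m) (charTheta θ), ∀ (v : V) (s : ℂ),
    r < s.re → Integrable (integrand ρ L v s) dg}, (r : EReal)

/-- `Γ_L(v) = ∫_{G_m} L(ρ(diag(g, I_{m+1})) v) |g| ^ s dg`. -/
def Gam (ρ : Representation ℂ (Gn F m) V) (dg : Measure (GL (Fin m) F)) (s : ℂ)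
    (L : Module.Dual ℂ V) (v : V) : ℂ :=
  ∫ g, integrand ρ L v s g ∂dg

end Integrals

end ExteriorSquare

end

/-!
The space of forms `Hom_{P_n ∩ S_n}(Π, Θ)` is mapped to `Hom_{P_n ∩ L_n}(Π, χ_{s₀})` by integration
along `diag(g, 1, 1)`, and two facts have to be seen.

*Equivariance* (`Gam_levi`). For `h ∈ P_n ∩ L_n` with diagonal blocks `g₁`, `g₂`, `1`, the matrix
`diag(g, 1, 1) h` is an element of the kernel of `Θ` times `diag(g₂⁻¹ g g₁, 1, 1)`. The change of
variable `g ↦ g₂⁻¹ g g₁` then gives the factor `χ_{s₀}(h)`, because `GL_m(F)` is unimodular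
(`isMulRightInvariant_GL`): the modular character is invariant under the automorphism `g ↦ ᵗg⁻¹`,
while diagonal matrices are symmetric and transvections are conjugate to their transposes, so that
the modular character equals its own inverse on generators of the group.

*Injectivity* (`eq_zero_of_Gam_eq_zero`). Let `n(z)` be the unipotent matrix with block `z` in
position `(1, 2)`. Since `diag(g, 1, 1) n(z) = n(g z) diag(g, 1, 1)`, replacing `v` by `Π(n(z)) v`
multiplies the integrand `f(g) = L(Π(diag(g, 1, 1)) v) |g| ^ s₀` by `θ(Tr(g z))`. If `Γ_L = 0`, the
Fourier transform of the integrable function `f` therefore vanishes. Integrating it over `z` in a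
lattice `c M_m(𝒪)`, against the conjugate of `θ(Tr z)`, shows by Fubini and the orthogonality of
characters that the integral of `f` over the neighbourhood
`{g | θ(Tr((g - 1) c x)) = 1 for all x ∈ M_m(𝒪)}` of `1` is zero (`setIntegral_dualNhd_eq_zero`).
For a suitable `c` this neighbourhood lies in the set of the `g` with `Π(diag(g, 1, 1)) v = v`
(`exists_dualNhd_subset`), where `f(g) = L(v) |g| ^ s₀`; hence `L(v) = 0`.
-/

noncomputable section

namespace ExteriorSquare

/-! ### Countability and local compactness of `F` and `GL_m(F)` -/

section Topology

variable {F : Type*} [Field F] [ValuativeRel F] [TopologicalSpace F] [IsNonarchimedeanLocalField F]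
  {m : ℕ}

variable (F) in
theorem t2Space_localField : T2Space F := by
  let := IsTopologicalAddGroup.rightUniformSpace F
  have := isUniformAddGroup_of_addCommGroup (G := F)
  infer_instance

variable (F) in
theorem secondCountableTopology_localField : SecondCountableTopology F := by
  let := IsTopologicalAddGroup.rightUniformSpace F
  have := isUniformAddGroup_of_addCommGroup (G := F)
  let : (Valued.v (R := F)).RankOne :=
  { hom' := ValuativeRel.IsRankLeOne.nonempty.some.emb (R := F).comp
      MonoidWithZeroHom.ValueGroup₀.embedding
    strictMono' := ValuativeRel.IsRankLeOne.nonempty.some.strictMono.comp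
      MonoidWithZeroHom.ValueGroup₀.embedding_strictMono }
  open scoped Valued in
  have : ProperSpace F := .of_nontriviallyNormedField_of_weaklyLocallyCompactSpace F
  exact secondCountable_of_proper

instance locallyCompactSpace_GL : LocallyCompactSpace (GL (Fin m) F) := by
  have := t2Space_localField F
  have : LocallyCompactSpace (Matrix (Fin m) (Fin m) F) :=
    inferInstanceAs (LocallyCompactSpace (Fin m → Fin m → F))
  have : T2Space (Matrix (Fin m) (Fin m) F) :=
    inferInstanceAs (T2Space (Fin m → Fin m → F))
  exact inferInstanceAs (LocallyCompactSpace (Matrix (Fin m) (Fin m) F)ˣ)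

instance secondCountableTopology_GL : SecondCountableTopology (GL (Fin m) F) := by
  have := secondCountableTopology_localField F
  have : SecondCountableTopology (Matrix (Fin m) (Fin m) F) :=
    inferInstanceAs (SecondCountableTopology (Fin m → Fin m → F))
  have : SecondCountableTopology (Matrix (Fin m) (Fin m) F)ᵐᵒᵖ :=
    MulOpposite.opHomeomorph.symm.isEmbedding.secondCountableTopology
  exact (Units.isEmbedding_embedProduct
    (M := Matrix (Fin m) (Fin m) F)).secondCountableTopology

/-- A neighbourhood of `1` in `GL_m(F)` contains every invertible matrix that is entrywise close
to `1`: by the adjugate formula, closeness of the inverse is automatic. -/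
theorem exists_nhds_entries_subset {U : Set (GL (Fin m) F)} (hU : U ∈ nhds 1) :
    ∃ W ∈ nhds (0 : F), ∀ g : GL (Fin m) F,
      (∀ i j, (g.val - 1) i j ∈ W) → g ∈ U := by
  have hc : ContinuousOn (fun M : Matrix (Fin m) (Fin m) F => M⁻¹) {M | IsUnit M} := by
    intro M hM
    have hdet : M.det ≠ 0 := ((Matrix.isUnit_iff_isUnit_det _).1 hM).ne_zero
    simp only [Matrix.inv_def, Ring.inverse_eq_inv']
    refine ContinuousAt.continuousWithinAt ?_
    exact ((Continuous.matrix_det continuous_id).continuousAt.inv₀ hdet).smul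
      (Continuous.matrix_adjugate continuous_id).continuousAt
  have hemb : Topology.IsEmbedding (Units.val : GL (Fin m) F → Matrix (Fin m) (Fin m) F) :=
    Units.isEmbedding_val_mk' hc fun u => (Matrix.coe_units_inv u).symm
  rw [hemb.nhds_eq_comap] at hU
  obtain ⟨T, hT, hTU⟩ := hU
  have hcont : Continuous (fun N : Matrix (Fin m) (Fin m) F => N + 1) :=
    continuous_id.add continuous_const
  have hT' : (fun N : Matrix (Fin m) (Fin m) F => N + 1) ⁻¹' T ∈
      nhds (0 : Matrix (Fin m) (Fin m) F) := by
    apply hcont.continuousAt.preimage_mem_nhds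
    simpa using hT
  have hT2 : ((fun N : Matrix (Fin m) (Fin m) F => N + 1) ⁻¹' T : Set (Fin m → Fin m → F)) ∈
      nhds (fun _ _ => 0 : Fin m → Fin m → F) := hT'
  rw [nhds_pi, Filter.mem_pi'] at hT2
  obtain ⟨I, t, ht, htT⟩ := hT2
  have ht' : ∀ i, ∃ s : Fin m → Set F, (∀ j, s j ∈ nhds (0 : F)) ∧ Set.univ.pi s ⊆ t i := by
    intro i
    have h := ht i
    rw [nhds_pi, Filter.mem_pi'] at h
    obtain ⟨J, s, hs, hst⟩ := h
    exact ⟨s, hs, (Set.pi_mono' (fun _ _ => subset_rfl) (Set.subset_univ _)).trans hst⟩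
  choose s hs hst using ht'
  refine ⟨⋂ i, ⋂ j, s i j, ?_, fun g hg => hTU ?_⟩
  · exact Filter.iInter_mem.2 fun i => Filter.iInter_mem.2 fun j => hs i j
  · have : (g.val - 1) ∈ (fun N : Matrix (Fin m) (Fin m) F => N + 1) ⁻¹' T := by
      apply htT
      intro i _
      apply hst i
      intro j _
      exact Set.mem_iInter.1 (Set.mem_iInter.1 (hg i j) i) j
    simpa using this

end Topology

/-! ### Unimodularity of `GL_m(F)` -/

section Unimodular

/-- The automorphism `g ↦ ᵗg⁻¹` of `GL_m`. -/
def transposeInv (K : Type*) [Field K] (m : ℕ) : GL (Fin m) K ≃* GL (Fin m) K where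
  toFun g := ⟨(g⁻¹).valᵀ, g.valᵀ, by rw [← transpose_mul, Units.mul_inv, transpose_one],
    by rw [← transpose_mul, Units.inv_mul, transpose_one]⟩
  invFun g := ⟨(g⁻¹).valᵀ, g.valᵀ, by rw [← transpose_mul, Units.mul_inv, transpose_one],
    by rw [← transpose_mul, Units.inv_mul, transpose_one]⟩
  left_inv g := Units.ext (transpose_transpose _)
  right_inv g := Units.ext (transpose_transpose _)
  map_mul' g h := Units.ext (by
    change ((g * h)⁻¹).valᵀ = _
    rw [_root_.mul_inv_rev, Units.val_mul, transpose_mul]; rfl)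

theorem inv_transposeInv_val {K : Type*} [Field K] {m : ℕ} (g : GL (Fin m) K) :
    ((transposeInv K m g)⁻¹).val = g.valᵀ := rfl

/-- Diagonal matrices are symmetric and elementary ones are conjugate to their transposes, so
a positive character that is invariant under `g ↦ ᵗg⁻¹` is its own inverse on generators. -/
theorem eq_one_of_transposeInv_invariant {K : Type*} [Field K] {m : ℕ} (χ : GL (Fin m) K →* ℝ≥0)
    (hχ : ∀ g, χ (transposeInv K m g) = χ g) (g : GL (Fin m) K) : χ g = 1 := by
  have key : ∀ g w : GL (Fin m) K, w.val * g.val = g.valᵀ * w.val → χ g = 1 := by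
    intro g w h
    have h1 : w * g = (transposeInv K m g)⁻¹ * w :=
      Units.ext (by rw [Units.val_mul, Units.val_mul, inv_transposeInv_val, h])
    have hinv : χ (transposeInv K m g) * χ ((transposeInv K m g)⁻¹) = 1 := by
      rw [← map_mul, mul_inv_cancel, map_one]
    have hw : χ w * χ w⁻¹ = 1 := by rw [← map_mul, mul_inv_cancel, map_one]
    have h2 := congrArg χ h1
    rw [map_mul, map_mul, mul_comm] at h2
    have h3 : χ g = χ ((transposeInv K m g)⁻¹) :=
      mul_right_cancel₀ (left_ne_zero_of_mul_eq_one hw) h2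
    rw [hχ, ← h3] at hinv
    rcases mul_self_eq_one_iff.1 (congrArg NNReal.toReal hinv) with h | h
    · exact NNReal.eq h
    · have h0 : (0 : ℝ) ≤ χ g := (χ g).coe_nonneg
      rw [show ((χ g : ℝ≥0) : ℝ) = -1 from h] at h0
      norm_num at h0
  have hdet : g.val.det ≠ 0 := ((Matrix.isUnit_iff_isUnit_det _).1 g.isUnit).ne_zero
  suffices ∀ h : GL (Fin m) K, h.val = g.val → χ h = 1 from this g rfl
  refine Matrix.diagonal_transvection_induction_of_det_ne_zero
    (fun M => ∀ h : GL (Fin m) K, h.val = M → χ h = 1) g.val hdet ?_ ?_ ?_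
  · intro D _ h hh
    exact key h 1 (by simp [hh])
  · intro t h hh
    let w : GL (Fin m) K := ⟨(Equiv.swap t.i t.j).toPEquiv.toMatrix,
      (Equiv.swap t.i t.j).toPEquiv.toMatrix, by
        rw [← PEquiv.toMatrix_trans, ← Equiv.toPEquiv_trans]; simp, by
        rw [← PEquiv.toMatrix_trans, ← Equiv.toPEquiv_trans]; simp⟩
    refine key h w ?_
    change (Equiv.swap t.i t.j).toPEquiv.toMatrix * h.val =
      h.valᵀ * (Equiv.swap t.i t.j).toPEquiv.toMatrix
    rw [PEquiv.toMatrix_toPEquiv_mul, PEquiv.mul_toMatrix_toPEquiv, hh]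
    ext a b
    have hne := t.hij
    simp only [TransvectionStruct.toMatrix, transvection, submatrix_apply, id, transpose_apply,
      Matrix.add_apply, Matrix.one_apply, Matrix.single_apply, Equiv.symm_swap]
    congr 1
    · refine if_congr ?_ rfl rfl
      rw [Equiv.swap_apply_eq_iff, eq_comm]
    · refine if_congr ?_ rfl rfl
      rw [← Equiv.swap_apply_eq_iff, Equiv.swap_apply_left, eq_comm (a := t.i),
        Equiv.swap_apply_eq_iff, Equiv.swap_apply_left]
      tauto
  · intro A B hA hB ihA ihB h hh
    have h1 := ihA (Matrix.GeneralLinearGroup.mkOfDetNeZero A hA) rfl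
    have h2 := ihB (Matrix.GeneralLinearGroup.mkOfDetNeZero B hB) rfl
    rw [show h = Matrix.GeneralLinearGroup.mkOfDetNeZero A hA *
      Matrix.GeneralLinearGroup.mkOfDetNeZero B hB from Units.ext hh, map_mul, h1, h2, one_mul]

variable {F : Type*} [Field F] [ValuativeRel F] [TopologicalSpace F] [IsNonarchimedeanLocalField F]
  {m : ℕ}

/-- The automorphism `g ↦ ᵗg⁻¹` as a homeomorphism. -/
def transposeInvHomeomorph (F : Type*) [Field F] [ValuativeRel F] [TopologicalSpace F]
    [IsNonarchimedeanLocalField F] (m : ℕ) : GL (Fin m) F ≃ₜ GL (Fin m) F where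
  toEquiv := (transposeInv F m).toEquiv
  continuous_toFun := Units.continuous_iff.2
    ⟨(Units.continuous_val.comp continuous_inv).matrix_transpose,
      Units.continuous_val.matrix_transpose⟩
  continuous_invFun := Units.continuous_iff.2
    ⟨(Units.continuous_val.comp continuous_inv).matrix_transpose,
      Units.continuous_val.matrix_transpose⟩

/-- `GL_m(F)` is unimodular. The modular character is invariant under the homeomorphic
automorphism `g ↦ ᵗg⁻¹`, since this automorphism carries a Haar measure to a Haar measure. -/
theorem isMulRightInvariant_GL [MeasurableSpace (GL (Fin m) F)] [BorelSpace (GL (Fin m) F)]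
    (μ : Measure (GL (Fin m) F)) [μ.IsHaarMeasure] : μ.IsMulRightInvariant := by
  have hmod : ∀ g : GL (Fin m) F, Measure.modularCharacter g = 1 := by
    refine eq_one_of_transposeInv_invariant _ fun g => ?_
    set σ := transposeInvHomeomorph F m
    let ν : Measure (GL (Fin m) F) := μ.map σ
    have hν : ν.IsHaarMeasure := (transposeInv F m).isHaarMeasure_map μ
      σ.continuous σ.symm.continuous
    have h1 : ν.map (· * σ g) = Measure.modularCharacterFun (σ g) • ν :=
      Measure.map_right_mul_eq_modularCharacterFun_smul ν (σ g)
    have h2 : ν.map (· * σ g) = Measure.modularCharacterFun g • ν := by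
      rw [← Measure.map_smul, ← Measure.map_right_mul_eq_modularCharacterFun_smul μ g,
        Measure.map_map (measurable_mul_const _) σ.measurable,
        Measure.map_map σ.measurable (measurable_mul_const _)]
      congr 1
      funext x
      exact ((transposeInv F m).map_mul x g).symm
    obtain ⟨K, hK, hK1⟩ := exists_compact_mem_nhds (1 : GL (Fin m) F)
    have h3 := congrArg (fun κ : Measure (GL (Fin m) F) => κ K) (h1.symm.trans h2)
    simp only [Measure.smul_apply, ENNReal.smul_def, smul_eq_mul] at h3
    exact ENNReal.coe_injective ((ENNReal.mul_left_inj
      (Measure.measure_pos_of_mem_nhds ν hK1).ne' hK.measure_lt_top.ne).1 h3)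
  refine ⟨fun g => ?_⟩
  rw [Measure.map_right_mul_eq_modularCharacterFun_smul μ g]
  have : Measure.modularCharacterFun g = 1 := hmod g
  rw [this, one_smul]

end Unimodular

/-! ### Fourier analysis on `M_m(F)` -/

section Fourier

/-- The circle has no small subgroups: squaring multiplies small distances to `1` by at
least `3 / 2`. -/
theorem circle_eq_one_of_pow_near_one (z : Circle)
    (h : ∀ n : ℕ, ‖((z ^ n : Circle) : ℂ) - 1‖ ≤ 1 / 2) : z = 1 := by
  have hstep : ∀ k : ℕ, (3 / 2 : ℝ) ^ k * ‖(z : ℂ) - 1‖ ≤ ‖((z ^ 2 ^ k : Circle) : ℂ) - 1‖ := by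
    intro k
    induction k with
    | zero => simp
    | succ k ih =>
      set w : ℂ := ((z ^ 2 ^ k : Circle) : ℂ)
      have h1 : ((z ^ 2 ^ (k + 1) : Circle) : ℂ) - 1 = (w + 1) * (w - 1) := by
        rw [pow_succ, pow_mul, Circle.coe_pow]
        ring
      have h2 : (3 / 2 : ℝ) ≤ ‖w + 1‖ := by
        have h3 : (2 : ℝ) ≤ ‖w + 1‖ + ‖w - 1‖ := by
          calc (2 : ℝ) = ‖(w + 1) - (w - 1)‖ := by norm_num
            _ ≤ _ := norm_sub_le _ _
        have h4 : ‖w - 1‖ ≤ 1 / 2 := h (2 ^ k)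
        linarith
      rw [h1, norm_mul, pow_succ', mul_assoc]
      exact mul_le_mul h2 ih (by positivity) (norm_nonneg _)
  by_contra hz
  have hpos : 0 < ‖(z : ℂ) - 1‖ := by
    rw [norm_pos_iff, sub_ne_zero]
    exact fun h => hz (Circle.ext h)
  obtain ⟨k, hk⟩ := pow_unbounded_of_one_lt (1 / ‖(z : ℂ) - 1‖) (by norm_num : (1 : ℝ) < 3 / 2)
  rw [div_lt_iff₀ hpos] at hk
  have := (hstep k).trans (h _)
  linarith

theorem circle_continuous_coe : Continuous fun z : Circle => (z : ℂ) := by fun_prop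

/-- Orthogonality: a nontrivial character has integral zero against an invariant measure. -/
theorem integral_addChar_eq_zero {A : Type*} [AddGroup A] [MeasurableSpace A] [MeasurableAdd A]
    (ν : Measure A) [ν.IsAddLeftInvariant] (ψ : AddChar A Circle) {a : A} (ha : ψ a ≠ 1) :
    ∫ x, (ψ x : ℂ) ∂ν = 0 := by
  have h := integral_add_left_eq_self (μ := ν) (fun x => (ψ x : ℂ)) a
  simp only [AddChar.map_add_eq_mul, Circle.coe_mul] at h
  rw [integral_const_mul] at h
  have h1 : ((ψ a : ℂ) - 1) * ∫ x, (ψ x : ℂ) ∂ν = 0 := by rw [sub_mul, h]; ring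
  refine (mul_eq_zero.1 h1).resolve_left fun h2 => ha ?_
  exact Circle.ext (by simpa [sub_eq_zero] using h2)

variable {F : Type*} [Field F] [ValuativeRel F] [TopologicalSpace F] [IsNonarchimedeanLocalField F]
  {m : ℕ}

/-- The lattice `M_m(𝒪)` of integral matrices, as a compact additive group. -/
abbrev IntMat (F : Type*) [Field F] [ValuativeRel F] (m : ℕ) : Type _ := Fin m → Fin m → 𝒪[F]

/-- The character `x ↦ θ(Tr((g - 1) c x))` of the lattice of integral matrices. -/
def latticeChar (θ : AddChar F Circle) (c : F) (g : GL (Fin m) F) :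
    AddChar (IntMat F m) Circle where
  toFun x := θ (trace ((g.val - 1) * (Matrix.of fun i j => c * (x i j : F))))
  map_zero_eq_one' := by
    rw [show (Matrix.of fun i j => c * (((0 : IntMat F m) i j : 𝒪[F]) : F)) = 0 by ext; simp]
    simp
  map_add_eq_mul' x y := by
    rw [← AddChar.map_add_eq_mul, ← trace_add, ← Matrix.mul_add]
    congr 3
    ext i j
    simp [mul_add]

theorem latticeChar_apply (θ : AddChar F Circle) (c : F) (g : GL (Fin m) F) (x : IntMat F m) :
    latticeChar θ c g x = θ (trace ((g.val - 1) * (Matrix.of fun i j => c * (x i j : F)))) := rfl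

theorem continuous_latticeChar {θ : AddChar F Circle} (hθ : Continuous θ) (c : F) :
    Continuous fun p : IntMat F m × GL (Fin m) F => latticeChar θ c p.2 p.1 := by
  simp only [latticeChar_apply]
  refine hθ.comp (Continuous.matrix_trace (Continuous.matrix_mul ?_ ?_))
  · exact (Units.continuous_val.comp continuous_snd).sub continuous_const
  · refine continuous_matrix fun i j => continuous_const.mul ?_
    exact continuous_subtype_val.comp
      ((continuous_apply j).comp ((continuous_apply i).comp continuous_fst))

/-- The set of the `g` for which the character `x ↦ θ(Tr((g - 1) c x))` of the lattice of integral
matrices is trivial: the intersection of `GL_m(F)` with the translate by `1` of a dual lattice. -/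
def dualNhd (m : ℕ) (θ : AddChar F Circle) (c : F) : Set (GL (Fin m) F) :=
  {g | ∀ x : IntMat F m, latticeChar θ c g x = 1}

theorem isClosed_dualNhd {θ : AddChar F Circle} (hθ : Continuous θ) (c : F) :
    IsClosed (dualNhd m θ c) := by
  have hset : dualNhd m θ c = ⋂ x : IntMat F m, (fun g => latticeChar θ c g x) ⁻¹' {1} := by
    ext g
    simp only [Set.mem_iInter, Set.mem_preimage, Set.mem_singleton_iff]
    exact Iff.rfl
  rw [hset]
  refine isClosed_iInter fun x => IsClosed.preimage ?_ isClosed_singleton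
  simp only [latticeChar_apply]
  exact hθ.comp (Continuous.matrix_trace (Continuous.matrix_mul
    (Units.continuous_val.sub continuous_const) continuous_const))

theorem dualNhd_mem_nhds {θ : AddChar F Circle} (hθ : Continuous θ) (c : F) :
    dualNhd m θ c ∈ nhds 1 := by
  have h : ∀ᶠ g in nhds (1 : GL (Fin m) F), ∀ x ∈ (Set.univ : Set (IntMat F m)),
      ‖((latticeChar θ c g x : Circle) : ℂ) - 1‖ < 1 / 2 := by
    refine isCompact_univ.eventually_forall_of_forall_eventually fun x _ => ?_
    have hc : Continuous fun p : GL (Fin m) F × IntMat F m =>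
        ‖((latticeChar θ c p.1 p.2 : Circle) : ℂ) - 1‖ :=
      ((circle_continuous_coe.comp
        ((continuous_latticeChar hθ c).comp continuous_swap)).sub continuous_const).norm
    refine hc.continuousAt.eventually_lt continuousAt_const ?_
    simp [latticeChar_apply]
  refine Filter.mem_of_superset h fun g hg x => circle_eq_one_of_pow_near_one _ fun n => ?_
  rw [← AddChar.map_nsmul_eq_pow]
  exact (hg _ (Set.mem_univ _)).le

/-- The dual lattices shrink to zero: if `θ a₀ ≠ 1` and `θ` is trivial on `a c 𝒪`, then
`|a c| < |a₀|`. -/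
theorem exists_dualNhd_subset {θ : AddChar F Circle} (hθ' : θ ≠ 1) {U : Set (GL (Fin m) F)}
    (hU : U ∈ nhds 1) : ∃ c : F, dualNhd m θ c ⊆ U := by
  obtain ⟨W, hW, hWU⟩ := exists_nhds_entries_subset hU
  obtain ⟨a₀, ha₀⟩ : ∃ a₀, θ a₀ ≠ 1 := by
    by_contra! h
    exact hθ' (DFunLike.ext _ _ h)
  obtain ⟨γ, hγ, hγW⟩ := (IsValuativeTopology.hasBasis_nhds_zero' F).mem_iff.1 hW
  obtain ⟨b, rfl⟩ := ValuativeRel.valuation_surjective γ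
  have hb : b ≠ 0 := by simpa using hγ
  -- if some entry `a` of `g - 1` has `|b| ≤ |a|`, testing against the integral matrix with the
  -- single entry `b / a` gives `θ a₀ = 1`
  refine ⟨a₀ / b, fun g hg => hWU g fun i j => hγW ?_⟩
  change ValuativeRel.valuation F _ < ValuativeRel.valuation F b
  by_contra! hlt
  set a := (g.val - 1) i j
  have hane : a ≠ 0 := by
    intro h
    rw [h, map_zero, le_zero_iff] at hlt
    exact hγ hlt
  have hint : ValuativeRel.valuation F (b / a) ≤ 1 := by
    rw [map_div₀]
    exact div_le_one_of_le₀ hlt zero_le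
  apply ha₀
  have h := hg (fun k l => if k = j ∧ l = i then ⟨b / a, hint⟩ else 0)
  rw [latticeChar_apply] at h
  rw [← h]
  congr 1
  have hsingle : (Matrix.of fun k l => a₀ / b * (((if k = j ∧ l = i then ⟨b / a, hint⟩ else 0 :
      𝒪[F])) : F)) = Matrix.single j i (a₀ / a) := by
    ext k l
    simp only [Matrix.of_apply, Matrix.single_apply]
    by_cases hkl : k = j ∧ l = i
    · rw [if_pos hkl, if_pos ⟨hkl.1.symm, hkl.2.symm⟩]
      change a₀ / b * (b / a) = _
      field_simp
    · rw [if_neg hkl, if_neg fun h => hkl ⟨h.1.symm, h.2.symm⟩]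
      simp
  rw [hsingle, Matrix.trace_mul_single]
  change a₀ = a * (a₀ / a)
  field_simp

/-- If the Fourier transform of an integrable function on `GL_m(F)` vanishes, so does its
integral over the neighbourhoods `dualNhd` of `1`: integrate the Fourier transform over a lattice
and exchange the integrals. -/
theorem setIntegral_dualNhd_eq_zero [MeasurableSpace (GL (Fin m) F)] [BorelSpace (GL (Fin m) F)]
    {θ : AddChar F Circle} (hθ : Continuous θ) {μ : Measure (GL (Fin m) F)} [SigmaFinite μ]
    {f : GL (Fin m) F → ℂ} (hf : Integrable f μ)
    (h0 : ∀ z : Matrix (Fin m) (Fin m) F, ∫ g, f g * (θ (trace (g.val * z)) : ℂ) ∂μ = 0) (c : F) :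
    ∫ g in dualNhd m θ c, f g ∂μ = 0 := by
  borelize (IntMat F m)
  have hsc := secondCountableTopology_localField F
  let ν : Measure (IntMat F m) := Measure.addHaar
  have hinner : ∀ x : IntMat F m, ∫ g, f g * (latticeChar θ c g x : ℂ) ∂μ = 0 := by
    intro x
    set z : Matrix (Fin m) (Fin m) F := Matrix.of fun i j => c * (x i j : F) with hz
    have h : ∀ g : GL (Fin m) F, f g * (latticeChar θ c g x : ℂ) =
        f g * (θ (trace (g.val * z)) : ℂ) * (θ (-trace z) : ℂ) := by
      intro g
      rw [latticeChar_apply, ← hz, Matrix.sub_mul, Matrix.one_mul, trace_sub, sub_eq_add_neg,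
        AddChar.map_add_eq_mul, Circle.coe_mul, mul_assoc]
    simp only [h]
    rw [integral_mul_const, h0, zero_mul]
  have houter : ∀ g : GL (Fin m) F, ∫ x, f g * (latticeChar θ c g x : ℂ) ∂ν =
      (dualNhd m θ c).indicator (fun g => f g * (ν.real Set.univ : ℂ)) g := by
    intro g
    rw [integral_const_mul]
    by_cases hg : g ∈ dualNhd m θ c
    · rw [Set.indicator_of_mem hg]
      have : ∀ x, (latticeChar θ c g x : ℂ) = 1 := fun x => by rw [hg x, Circle.coe_one]
      simp [this]
    · rw [Set.indicator_of_notMem hg]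
      obtain ⟨x, hx⟩ := not_forall.1 hg
      rw [integral_addChar_eq_zero ν (latticeChar θ c g) hx, mul_zero]
  have hint : Integrable (Function.uncurry fun (x : IntMat F m) (g : GL (Fin m) F) =>
      f g * (latticeChar θ c g x : ℂ)) (ν.prod μ) := by
    have h1 : Integrable (fun p : IntMat F m × GL (Fin m) F => f p.2) (ν.prod μ) :=
      hf.comp_snd ν
    refine h1.mul_bdd (c := 1) ?_ ?_
    · exact (circle_continuous_coe.comp (continuous_latticeChar hθ c)).aestronglyMeasurable
    · exact Filter.Eventually.of_forall fun p => (Circle.norm_coe _).le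
  have hswap := integral_integral_swap hint
  simp only [hinner, houter, integral_zero] at hswap
  rw [integral_indicator (isClosed_dualNhd hθ c).measurableSet, integral_mul_const] at hswap
  refine (mul_eq_zero.1 hswap.symm).resolve_right ?_
  have : 0 < ν.real Set.univ := by
    rw [measureReal_def, ENNReal.toReal_pos_iff]
    exact ⟨isOpen_univ.measure_pos ν Set.univ_nonempty, measure_lt_top ν _⟩
  exact_mod_cast this.ne'

end Fourier

/-! ### Transformation rules of the integrand -/

section Shalika

variable {F : Type*} [Field F] {m : ℕ} {V : Type*} [AddCommGroup V] [Module ℂ V]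

theorem homSpace_shalika_apply {θ : AddChar F Circle} {ρ : Representation ℂ (Gn F m) V}
    {L : Module.Dual ℂ V}
    (hL : L ∈ homSpace ρ (mirabolic F m ⊓ shalika F m) (charTheta θ)) {M : Gn F m}
    {g : GL (Fin m) F} {z : Matrix (Fin m) (Fin m) F} {y : Matrix (Fin m) Unit F}
    (hM : (M : Matrix (Ix m) (Ix m) F) = blk g.val z y 0 g.val 0 0 0 1) (v : V) :
    L (ρ M v) = (θ (trace (z * (g⁻¹).val)) : ℂ) * L v := by
  have hmem := (mem_mirabolic_inf_shalika_iff M).2 ⟨g, z, y, hM⟩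
  have h := hL ⟨M, hmem⟩ v
  rw [h]
  congr 1
  change (θ (trace (block₁₂ M * (block₁₁ M)⁻¹)) : ℂ) = _
  rw [(blocks_of_eq_blk hM).1, (blocks_of_eq_blk hM).2.1, Matrix.coe_units_inv]

/-- The unipotent matrix with blocks `1 z 0`, `0 1 0`, `0 0 1`. -/
def unipotent (z : Matrix (Fin m) (Fin m) F) : Gn F m where
  val := blk 1 z 0 0 1 0 0 0 1
  inv := blk 1 (-z) 0 0 1 0 0 0 1
  val_inv := by rw [blk_mul, ← blk_one]; simp
  inv_val := by rw [blk_mul, ← blk_one]; simp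

theorem apply_diagEmb_unipotent {θ : AddChar F Circle} {ρ : Representation ℂ (Gn F m) V}
    {L : Module.Dual ℂ V}
    (hL : L ∈ homSpace ρ (mirabolic F m ⊓ shalika F m) (charTheta θ)) (g : GL (Fin m) F)
    (z : Matrix (Fin m) (Fin m) F) (v : V) :
    L (ρ (diagEmb g) (ρ (unipotent z) v)) =
      (θ (trace (g.val * z)) : ℂ) * L (ρ (diagEmb g) v) := by
  have h1 : diagEmb g * unipotent z = unipotent (g.val * z) * diagEmb g := by
    apply Units.ext
    change blk _ _ _ _ _ _ _ _ _ * blk _ _ _ _ _ _ _ _ _ =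
      blk _ _ _ _ _ _ _ _ _ * blk _ _ _ _ _ _ _ _ _
    rw [blk_mul, blk_mul]
    simp
  rw [← Module.End.mul_apply, ← map_mul, h1, map_mul, Module.End.mul_apply,
    homSpace_shalika_apply hL (g := 1) (z := g.val * z) (y := 0) rfl]
  simp

/-- `diag(g, 1, 1) h` is the product of an element of the kernel of `Θ` and of
`diag(g₂⁻¹ g g₁, 1, 1)`, for `h` in `P_n ∩ L_n` with diagonal blocks `g₁`, `g₂`, `1`. -/
theorem apply_diagEmb_levi {θ : AddChar F Circle} {ρ : Representation ℂ (Gn F m) V}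
    {L : Module.Dual ℂ V}
    (hL : L ∈ homSpace ρ (mirabolic F m ⊓ shalika F m) (charTheta θ)) {h : Gn F m}
    {g₁ g₂ : GL (Fin m) F} {u : Matrix (Fin m) Unit F}
    (hh : (h : Matrix (Ix m) (Ix m) F) = blk g₁.val 0 u 0 g₂.val 0 0 0 1)
    (g : GL (Fin m) F) (v : V) :
    L (ρ (diagEmb g) (ρ h v)) = L (ρ (diagEmb (g₂⁻¹ * g * g₁)) v) := by
  have hM : ((diagEmb g * h * (diagEmb (g₂⁻¹ * g * g₁))⁻¹ : Gn F m) : Matrix (Ix m) (Ix m) F) =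
      blk g₂.val 0 (g.val * u) 0 g₂.val 0 0 0 1 := by
    have h1 : g.val * g₁.val * ((g₂⁻¹ * g * g₁)⁻¹).val = g₂.val := by
      rw [← Units.val_mul, ← Units.val_mul]
      congr 1
      group
    change blk _ _ _ _ _ _ _ _ _ * h.val * blk _ _ _ _ _ _ _ _ _ = _
    rw [hh, blk_mul, blk_mul]
    simp only [Matrix.mul_zero, Matrix.mul_one, Matrix.zero_mul, Matrix.one_mul, add_zero,
      zero_add, h1]
  have h2 : diagEmb g * h = diagEmb g * h * (diagEmb (g₂⁻¹ * g * g₁))⁻¹ *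
      diagEmb (g₂⁻¹ * g * g₁) := by group
  rw [← Module.End.mul_apply, ← map_mul, h2, map_mul, Module.End.mul_apply,
    homSpace_shalika_apply hL hM]
  simp

end Shalika

variable {F : Type*} [Field F] [ValuativeRel F] [TopologicalSpace F] [IsNonarchimedeanLocalField F]
  {m : ℕ} {V : Type*} [AddCommGroup V] [Module ℂ V]

theorem absDet_pos (g : GL (Fin m) F) : 0 < absDet g.val := by
  have hdet : g.val.det ≠ 0 := ((Matrix.isUnit_iff_isUnit_det _).1 g.isUnit).ne_zero
  refine lt_of_le_of_ne (absDet_nonneg _) (Ne.symm ?_)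
  simpa [absDet] using hdet

theorem integrand_levi {θ : AddChar F Circle} {ρ : Representation ℂ (Gn F m) V}
    {L : Module.Dual ℂ V}
    (hL : L ∈ homSpace ρ (mirabolic F m ⊓ shalika F m) (charTheta θ)) {h : Gn F m}
    {g₁ g₂ : GL (Fin m) F} {u : Matrix (Fin m) Unit F}
    (hh : (h : Matrix (Ix m) (Ix m) F) = blk g₁.val 0 u 0 g₂.val 0 0 0 1)
    (s : ℂ) (g : GL (Fin m) F) (v : V) :
    integrand ρ L (ρ h v) s g = ((absDet g₁.val / absDet g₂.val : ℝ) : ℂ) ^ (-s) *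
      integrand ρ L v s (g₂⁻¹ * g * g₁) := by
  have h1 := absDet_pos g₁
  have h2 := absDet_pos g₂
  have hg : absDet (g₂⁻¹ * g * g₁ : GL (Fin m) F).val =
      absDet g.val * (absDet g₁.val / absDet g₂.val) := by
    have h3 : absDet (g₂⁻¹).val * absDet g₂.val = 1 := by
      rw [← absDet_mul, Units.inv_mul, absDet_one]
    rw [Units.val_mul, Units.val_mul, absDet_mul, absDet_mul]
    field_simp
    linear_combination absDet g.val * h3
  have hq : ((absDet g₁.val / absDet g₂.val : ℝ) : ℂ) ≠ 0 :=
    Complex.ofReal_ne_zero.2 (div_pos h1 h2).ne'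
  rw [integrand, integrand, apply_diagEmb_levi hL hh, hg, Complex.ofReal_mul,
    Complex.mul_cpow_ofReal_nonneg (absDet_nonneg _) (div_pos h1 h2).le, Complex.cpow_neg]
  have hne : ((absDet g₁.val / absDet g₂.val : ℝ) : ℂ) ^ s ≠ 0 := by
    rw [Complex.cpow_def_of_ne_zero hq]
    exact Complex.exp_ne_zero _
  field_simp

theorem integrand_unipotent {θ : AddChar F Circle} {ρ : Representation ℂ (Gn F m) V}
    {L : Module.Dual ℂ V}
    (hL : L ∈ homSpace ρ (mirabolic F m ⊓ shalika F m) (charTheta θ))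
    (z : Matrix (Fin m) (Fin m) F) (s : ℂ) (g : GL (Fin m) F) (v : V) :
    integrand ρ L (ρ (unipotent z) v) s g =
      integrand ρ L v s g * (θ (trace (g.val * z)) : ℂ) := by
  rw [integrand, integrand, apply_diagEmb_unipotent hL]
  ring

theorem continuous_diagEmb : Continuous (diagEmb : GL (Fin m) F → Gn F m) := by
  have h : ∀ f : GL (Fin m) F → Matrix (Fin m) (Fin m) F, Continuous f →
      Continuous fun g => (blk (f g) 0 0 0 1 0 0 0 1 : Matrix (Ix m) (Ix m) F) := fun f hf =>
    (hf.matrix_fromBlocks continuous_const continuous_const continuous_const).matrix_fromBlocks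
      continuous_const continuous_const continuous_const
  exact Units.continuous_iff.2 ⟨h _ Units.continuous_val,
    h _ (Units.continuous_val.comp continuous_inv)⟩

/-! ### The map `L ↦ Γ_L` -/

section Gamma

variable [MeasurableSpace (GL (Fin m) F)] [BorelSpace (GL (Fin m) F)]
  {dg : Measure (GL (Fin m) F)} [dg.IsHaarMeasure]

theorem integrable_integrand_of_abscissa_lt {θ : AddChar F Circle}
    {ρ : Representation ℂ (Gn F m) V} {s₀ : ℝ} (hs₀ : abscissa ρ θ dg < (s₀ : EReal))
    {L : Module.Dual ℂ V}
    (hL : L ∈ homSpace ρ (mirabolic F m ⊓ shalika F m) (charTheta θ)) (v : V) :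
    Integrable (integrand ρ L v (s₀ : ℂ)) dg := by
  simp only [abscissa, iInf_lt_iff] at hs₀
  obtain ⟨r, hr, hlt⟩ := hs₀
  exact hr L hL v s₀ (by simpa using hlt)

theorem Gam_levi {θ : AddChar F Circle} {ρ : Representation ℂ (Gn F m) V} {L : Module.Dual ℂ V}
    (hL : L ∈ homSpace ρ (mirabolic F m ⊓ shalika F m) (charTheta θ)) (s : ℂ)
    (h : ↥(mirabolic F m ⊓ levi F m)) (v : V) :
    Gam ρ dg s L (ρ (h : Gn F m) v) = charChi s h * Gam ρ dg s L v := by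
  obtain ⟨h, hmem⟩ := h
  obtain ⟨g₁, g₂, u, hh⟩ := (mem_mirabolic_inf_levi_iff h).1 hmem
  have hχ : charChi s ⟨h, hmem⟩ = ((absDet g₁.val / absDet g₂.val : ℝ) : ℂ) ^ (-s) := by
    change ((absDet (block₁₁ h) / absDet (block₂₂ h) : ℝ) : ℂ) ^ (-s) = _
    rw [(blocks_of_eq_blk hh).1, (blocks_of_eq_blk hh).2.2]
  have hright := isMulRightInvariant_GL dg
  simp only [Gam, hχ, integrand_levi hL hh]
  rw [integral_const_mul, integral_mul_left_eq_self (fun g => integrand ρ L v s (g * g₁)) g₂⁻¹,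
    integral_mul_right_eq_self]

/-- A vanishing `Γ_L` makes the Fourier transform of `g ↦ L(ρ(diag(g, 1)) v) |g| ^ s` vanish.
Near `g = 1` this function is `L v` times a positive function. -/
theorem eq_zero_of_Gam_eq_zero {θ : AddChar F Circle} (hθ : Continuous θ) (hθ' : θ ≠ 1)
    {ρ : Representation ℂ (Gn F m) V} (hρ : IsSmoothRep ρ) {s : ℝ} {L : Module.Dual ℂ V}
    (hL : L ∈ homSpace ρ (mirabolic F m ⊓ shalika F m) (charTheta θ))
    (hint : ∀ v, Integrable (integrand ρ L v (s : ℂ)) dg)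
    (hΓ : ∀ v, Gam ρ dg (s : ℂ) L v = 0) : L = 0 := by
  ext v
  rw [LinearMap.zero_apply]
  obtain ⟨U, hU, hUv⟩ := hρ v
  have hU1 : (diagEmb : GL (Fin m) F → Gn F m) ⁻¹' (U : Set (Gn F m)) ∈ nhds 1 := by
    refine continuous_diagEmb.continuousAt.preimage_mem_nhds (hU.mem_nhds ?_)
    rw [show diagEmb (1 : GL (Fin m) F) = 1 from Units.ext blk_one]
    exact U.one_mem
  obtain ⟨c, hc⟩ := exists_dualNhd_subset hθ' hU1
  set B := dualNhd m θ c
  have hBm : MeasurableSet B := (isClosed_dualNhd hθ c).measurableSet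
  have hzero : ∫ g in B, integrand ρ L v (s : ℂ) g ∂dg = 0 := by
    refine setIntegral_dualNhd_eq_zero hθ (hint v) (fun z => ?_) c
    simp only [← integrand_unipotent hL]
    exact hΓ _
  have heq : Set.EqOn (integrand ρ L v (s : ℂ))
      (fun g => L v * ((absDet g.val ^ s : ℝ) : ℂ)) B := by
    intro g hg
    simp only [integrand]
    rw [hUv _ (hc hg), Complex.ofReal_cpow (absDet_nonneg _)]
  rw [setIntegral_congr_fun hBm heq, integral_const_mul, integral_complex_ofReal, mul_eq_zero] at hzero
  refine hzero.elim id fun h0 => ?_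
  by_contra hLv
  have hI : IntegrableOn (fun g : GL (Fin m) F => absDet g.val ^ s) B dg := by
    have h1 := ((integrableOn_congr_fun heq hBm).1 (hint v).integrableOn).const_mul (L v)⁻¹
    simp only [inv_mul_cancel_left₀ hLv] at h1
    simpa [IntegrableOn] using h1.re
  have hpos : 0 < ∫ g in B, absDet g.val ^ s ∂dg := by
    rw [setIntegral_pos_iff_support_of_nonneg_ae
      (Filter.Eventually.of_forall fun g => Real.rpow_nonneg (absDet_nonneg _) s) hI]
    have hsupp : Function.support (fun g : GL (Fin m) F => absDet g.val ^ s) = Set.univ :=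
      Set.eq_univ_of_forall fun g => (Real.rpow_pos_of_pos (absDet_pos g) s).ne'
    rw [hsupp, Set.univ_inter]
    exact Measure.measure_pos_of_mem_nhds dg (dualNhd_mem_nhds hθ c)
  exact hpos.ne' (Complex.ofReal_eq_zero.1 h0)

end Gamma

end ExteriorSquare

end

theorem proposition3p3 {F : Type*} [Field F] [ValuativeRel F] [TopologicalSpace F]
    [IsNonarchimedeanLocalField F] (m : ℕ)
    (θ : AddChar F Circle) (hθ : Continuous θ) (hθ' : θ ≠ 1)
    {V : Type*} [AddCommGroup V] [Module ℂ V]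
    (ρ : Representation ℂ (ExteriorSquare.Gn F m) V) (hρ : ExteriorSquare.IsSmoothRep ρ)
    [MeasurableSpace (GL (Fin m) F)] [BorelSpace (GL (Fin m) F)]
    (dg : Measure (GL (Fin m) F)) [dg.IsHaarMeasure]
    (s₀ : ℝ) (hs₀ : ExteriorSquare.abscissa ρ θ dg < (s₀ : EReal)) :
    (∀ L ∈ ExteriorSquare.homSpace ρ
        (ExteriorSquare.mirabolic F m ⊓ ExteriorSquare.shalika F m) (ExteriorSquare.charTheta θ),
      ∀ v : V, Integrable (ExteriorSquare.integrand ρ L v (s₀ : ℂ)) dg) ∧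
    ∃ T : ExteriorSquare.homSpace ρ
          (ExteriorSquare.mirabolic F m ⊓ ExteriorSquare.shalika F m)
          (ExteriorSquare.charTheta θ) →ₗ[ℂ]
        ExteriorSquare.homSpace ρ
          (ExteriorSquare.mirabolic F m ⊓ ExteriorSquare.levi F m)
          (ExteriorSquare.charChi (s₀ : ℂ)),
      (∀ L v, (T L : Module.Dual ℂ V) v =
        ExteriorSquare.Gam ρ dg (s₀ : ℂ) (L : Module.Dual ℂ V) v) ∧
      Function.Injective T := by
  refine ⟨fun L hL v => ExteriorSquare.integrable_integrand_of_abscissa_lt hs₀ hL v, ?_⟩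
  have hint := fun (L : ExteriorSquare.homSpace ρ
      (ExteriorSquare.mirabolic F m ⊓ ExteriorSquare.shalika F m)
      (ExteriorSquare.charTheta θ)) =>
    ExteriorSquare.integrable_integrand_of_abscissa_lt hs₀ L.2
  refine ⟨{
    toFun := fun L => ⟨{
      toFun := ExteriorSquare.Gam ρ dg (s₀ : ℂ) (L : Module.Dual ℂ V)
      map_add' := fun v w => ?_
      map_smul' := fun a v => ?_ }, ExteriorSquare.Gam_levi L.2 _⟩
    map_add' := fun L L' => ?_
    map_smul' := fun a L => ?_ }, fun L v => rfl, ?_⟩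
  · simp only [ExteriorSquare.Gam]
    rw [← integral_add (hint L v) (hint L w)]
    congr 1 with g
    simp [ExteriorSquare.integrand, add_mul]
  · simp only [ExteriorSquare.Gam, RingHom.id_apply, smul_eq_mul]
    rw [← integral_const_mul]
    congr 1 with g
    simp [ExteriorSquare.integrand, mul_assoc]
  · ext v
    simp only [LinearMap.coe_mk, AddHom.coe_mk, Submodule.coe_add, LinearMap.add_apply,
      ExteriorSquare.Gam]
    rw [← integral_add (hint L v) (hint L' v)]
    congr 1 with g
    simp [ExteriorSquare.integrand, add_mul]
  · ext v
    simp only [LinearMap.coe_mk, AddHom.coe_mk, Submodule.coe_smul, LinearMap.smul_apply,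
      RingHom.id_apply, smul_eq_mul, ExteriorSquare.Gam]
    rw [← integral_const_mul]
    congr 1 with g
    simp [ExteriorSquare.integrand, mul_assoc]
  · refine (injective_iff_map_eq_zero _).2 fun L hL => Subtype.ext ?_
    exact ExteriorSquare.eq_zero_of_Gam_eq_zero hθ hθ' hρ L.2 (hint L)
      fun v => DFunLike.congr_fun (congrArg Subtype.val hL) v
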